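/- Let $\Omega$ be a locally compact Hausdorff space, and let $M(\Omega)$ be the Banach space of complex regular Borel measures on $\Omega$ with the total variation norm $\|\mu\|=|\mu|(\Omega)$. Definitions. For a Banach space $E$ with dual $E'$, $1\le p,q<\infty$, $n\in\mathbb N=\{1,2,\dots\}$ and $x=(x_1,\dots,x_n)\in E^n$, let $$\mu_{p,n}(x)=\sup\Big\{\Big(\sum_{i=1}^n|\langle x_i,\varphi\rangle|^p\Big)^{1/p}:\varphi\in E',\ \|\varphi\|\le1\Big\}$$ be the weak $p$-summing norm (for elements of $(E')^n$ it is computed in the Banach space $E'$), and let $$\|x\|_n^{(p,q)}=\sup\Big\{\Big(\sum_{i=1}^n|\langle x_i,\lambda_i\rangle|^q\Big)^{1/q}:\lambda=(\lambda_1,\dots,\lambda_n)\in(E')^n,\ \mu_{p,n}(\lambda)\le1\Big\},$$ which for $p\le q$ is the weak $(p,q)$-multi-norm over $E$. A multi-norm over $E$ is a sequence of norms $\|\cdot\|_n$ on $E^n$ $(n\in\mathbb N)$, with $\|\cdot\|_1$ the norm of $E$, such that for all $n\ge2$: $\|\cdot\|_n$ is invariant under permutations of the coordinates; $\|(\alpha_1x_1,\dots,\alpha_nx_n)\|_n\le\max_i|\alpha_i|\,\|(x_1,\dots,x_n)\|_n$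 for $\alpha_1,\dots,\alpha_n\in\mathbb C$; $\|(x_1,\dots,x_{n-1},0)\|_n=\|(x_1,\dots,x_{n-1})\|_{n-1}$; and $\|(x_1,\dots,x_{n-1},x_{n-1})\|_n=\|(x_1,\dots,x_{n-1})\|_{n-1}$. The maximum multi-norm over $E$ is the multi-norm over $E$ that dominates every multi-norm over $E$. A measurable partition $\mathbf X=(X_1,\dots,X_n)$ of $\Omega$ consists of pairwise disjoint Borel sets, some possibly empty, with union $\Omega$. For a Borel set $X$ and $\mu\in M(\Omega)$, $P_X(\mu)(E)=\mu(X\cap E)$. For positive measures, $\vee$ denotes the least upper bound; explicitly, $(\mu\vee\nu)(E)=\sup\{\mu(E_1)+\nu(E_2)\}$ over the measurable partitions $(E_1,E_2)$ of $E$. Theorem. (1) The maximum multi-norm over $M(\Omega)$ is given by $$\|(\mu_1,\dots,\mu_n)\|_n^{\max}=\big\|\,|\mu_1|\vee\cdots\vee|\mu_n|\,\big\|\qquad(n\in\mathbb N,\ \mu_1,\dots,\mu_n\in M(\Omega)).$$ (2) Let $1\le q<\infty$. The weak $(1,q)$-multi-norm over $M(\Omega)$ is given by $$\|(\mu_1,\dots,\mu_n)\|_n^{(1,q)}=\sup_{\mathbf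 X}\Big(\sum_{i=1}^n\|P_{X_i}(\mu_i)\|^q\Big)^{1/q}\qquad(n\in\mathbb N,\ \mu_1,\dots,\mu_n\in M(\Omega)),$$ where the supremum, which is finite, is taken over all measurable partitions $\mathbf X=(X_1,\dots,X_n)$ of $\Omega$. -/

import Mathlib

open MeasureTheory Set
open scoped ENNReal NNReal

noncomputable section

/-! ### Multi-norms over a normed space -/

section MultiNorm

variable {E : Type*} [NormedAddCommGroup E] [NormedSpace ℂ E]

/-- The weak `p`-summing norm
`μ_{p,n}(x) = sup {(∑ |⟨x_i, φ⟩|^p)^{1/p} : φ ∈ E', ‖φ‖ ≤ 1}` of `x ∈ E^n`. -/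
def weakSummingNorm (p : ℝ) {n : ℕ} (x : Fin n → E) : ℝ :=
  sSup {r : ℝ | ∃ φ : StrongDual ℂ E, ‖φ‖ ≤ 1 ∧ r = (∑ i, ‖φ (x i)‖ ^ p) ^ (1 / p)}

/-- The weak `(p,q)`-multi-norm
`‖x‖_n^{(p,q)} = sup {(∑ |⟨x_i, φ_i⟩|^q)^{1/q} : φ ∈ (E')^n, μ_{p,n}(φ) ≤ 1}` of `x ∈ E^n`.
Here `μ_{p,n}(φ)` is computed in the Banach space `E'`, so against the unit ball of `E''`. -/
def weakMultiNorm (p q : ℝ) {n : ℕ} (x : Fin n → E) : ℝ :=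
  sSup {r : ℝ | ∃ φ : Fin n → StrongDual ℂ E,
    weakSummingNorm p φ ≤ 1 ∧ r = (∑ i, ‖φ i (x i)‖ ^ q) ^ (1 / q)}

/-- `N = (N 1, N 2, …)` is a multi-norm over `E`: each `N n` (`n ≥ 1`) is a norm on `E^n`, `N 1` is
the norm of `E`, and the remaining fields hold. The value `N 0` is irrelevant.
In `smul_le` the norm `‖α‖` of `α : Fin n → ℂ` is the maximum of the `|α_i|`. -/
structure IsMultiNorm (N : (n : ℕ) → (Fin n → E) → ℝ) : Prop where
  add_le : ∀ n, 1 ≤ n → ∀ x y : Fin n → E, N n (x + y) ≤ N n x + N n y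
  smul : ∀ n, 1 ≤ n → ∀ (c : ℂ) (x : Fin n → E), N n (c • x) = ‖c‖ * N n x
  eq_zero : ∀ n, 1 ≤ n → ∀ x : Fin n → E, N n x = 0 → x = 0
  one : ∀ x : E, N 1 (fun _ => x) = ‖x‖
  perm : ∀ n, 2 ≤ n → ∀ (σ : Equiv.Perm (Fin n)) (x : Fin n → E), N n (x ∘ σ) = N n x
  smul_le : ∀ n, 2 ≤ n → ∀ (α : Fin n → ℂ) (x : Fin n → E),
    N n (fun i => α i • x i) ≤ ‖α‖ * N n x
  snoc_zero : ∀ n, 1 ≤ n → ∀ x : Fin n → E,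
    N (n + 1) (Fin.snoc (α := fun _ => E) x 0) = N n x
  snoc_last : ∀ n, ∀ x : Fin (n + 1) → E,
    N (n + 2) (Fin.snoc (α := fun _ => E) x (x (Fin.last n))) = N (n + 1) x

/-- `N` is the maximum multi-norm over `E`: it is a multi-norm over `E`, and it dominates every
multi-norm over `E`. -/
def IsMaximumMultiNorm (N : (n : ℕ) → (Fin n → E) → ℝ) : Prop :=
  IsMultiNorm N ∧ ∀ N' : (n : ℕ) → (Fin n → E) → ℝ, IsMultiNorm N' →
    ∀ n, 1 ≤ n → ∀ x : Fin n → E, N' n x ≤ N n x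

end MultiNorm

/-! ### Total variation and regularity -/

section Aux

theorem variation_complexMeasure_lt_top {Ω : Type*} [MeasurableSpace Ω] (μ : ComplexMeasure Ω) :
    μ.variation univ < ∞ := by
  have h : μ.variation ≤ (ComplexMeasure.re μ).totalVariation
      + (ComplexMeasure.im μ).totalVariation := by
    apply VectorMeasure.variation_le_of_forall_enorm_le
    intro E hE
    have h1 : ‖μ E‖ₑ ≤ ‖(μ E).re‖ₑ + ‖(μ E).im‖ₑ := by
      have := Complex.norm_le_abs_re_add_abs_im (μ E)
      rw [← Real.norm_eq_abs, ← Real.norm_eq_abs] at this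
      have h2 := ENNReal.ofReal_le_ofReal this
      rwa [ENNReal.ofReal_add (norm_nonneg _) (norm_nonneg _), ofReal_norm, ofReal_norm,
        ofReal_norm] at h2
    refine h1.trans ?_
    rw [Measure.add_apply]
    exact add_le_add ((ComplexMeasure.re μ).enorm_le_totalVariation E)
      ((ComplexMeasure.im μ).enorm_le_totalVariation E)
  refine (h univ).trans_lt ?_
  rw [Measure.add_apply]
  exact ENNReal.add_lt_top.2 ⟨measure_lt_top _ _, measure_lt_top _ _⟩

instance isFiniteMeasure_variation_complexMeasure {Ω : Type*} [MeasurableSpace Ω]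
    (μ : ComplexMeasure Ω) : IsFiniteMeasure μ.variation :=
  ⟨variation_complexMeasure_lt_top μ⟩

/-- On finite measures, Mathlib's supremum of measures (the least measure above both) is given by
`(μ ∨ ν)(E) = sup {μ(E₁) + ν(E₂) : (E₁, E₂) a measurable partition of E}`. -/
theorem measure_sup_apply_eq {Ω : Type*} [MeasurableSpace Ω] (μ ν : Measure Ω)
    [IsFiniteMeasure μ] [IsFiniteMeasure ν] {E : Set Ω} (hE : MeasurableSet E) :
    (μ ⊔ ν) E = sSup {r : ℝ≥0∞ | ∃ E₁ E₂ : Set Ω, MeasurableSet E₁ ∧ MeasurableSet E₂ ∧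
      Disjoint E₁ E₂ ∧ E₁ ∪ E₂ = E ∧ r = μ E₁ + ν E₂} := by
  apply le_antisymm
  · obtain ⟨s, hs, h1, h2⟩ := hahn_decomposition μ ν
    have key : μ ⊔ ν ≤ μ.restrict s + ν.restrict sᶜ := by
      refine sup_le ?_ ?_
      · refine Measure.le_iff.2 fun t ht => ?_
        rw [Measure.add_apply, Measure.restrict_apply ht, Measure.restrict_apply ht,
          ← measure_inter_add_sdiff t hs]
        exact add_le_add le_rfl (h2 _ (ht.diff hs) (fun x hx => hx.2))
      · refine Measure.le_iff.2 fun t ht => ?_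
        rw [Measure.add_apply, Measure.restrict_apply ht, Measure.restrict_apply ht,
          ← measure_inter_add_sdiff t hs]
        exact add_le_add (h1 _ (ht.inter hs) (fun x hx => hx.2)) le_rfl
    refine (key E).trans ?_
    rw [Measure.add_apply, Measure.restrict_apply hE, Measure.restrict_apply hE]
    refine le_sSup ⟨E ∩ s, E ∩ sᶜ, hE.inter hs, hE.inter hs.compl, ?_, ?_, rfl⟩
    · exact disjoint_compl_right.mono inter_subset_right inter_subset_right
    · exact inter_union_compl E s
  · refine sSup_le ?_
    rintro r ⟨E₁, E₂, -, h₂, hd, rfl, rfl⟩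
    rw [measure_union hd h₂]
    exact add_le_add ((le_sup_left : μ ≤ μ ⊔ ν) E₁) ((le_sup_right : ν ≤ μ ⊔ ν) E₂)

variable {Ω : Type*} [TopologicalSpace Ω] [T2Space Ω] [MeasurableSpace Ω] [BorelSpace Ω]

theorem regular_of_le_regular {m m' : Measure Ω} [IsFiniteMeasure m'] [m'.Regular]
    (h : m ≤ m') : m.Regular := by
  have hm : IsFiniteMeasure m := isFiniteMeasure_of_le m' h
  have ho : m.OuterRegular := by
    constructor
    intro A hA r hr
    obtain ⟨U, hAU, hU, -, hd⟩ := hA.exists_isOpen_sdiff_lt (measure_ne_top m' A)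
      (tsub_pos_of_lt hr).ne'
    refine ⟨U, hAU, hU, ?_⟩
    calc m U = m (U ∩ A) + m (U \ A) := (measure_inter_add_sdiff U hA).symm
      _ ≤ m A + m' (U \ A) := add_le_add (measure_mono inter_subset_right) (h _)
      _ < m A + (r - m A) := ENNReal.add_lt_add_left (measure_ne_top m A) hd
      _ = r := add_tsub_cancel_of_le hr.le
  refine ⟨?_⟩
  intro U hU r hr
  obtain ⟨K, hKU, hK, hd⟩ := hU.measurableSet.exists_isCompact_sdiff_lt (measure_ne_top m' U)
    (tsub_pos_of_lt hr).ne'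
  refine ⟨K, hKU, hK, ?_⟩
  by_contra hle
  have : m U < m U := calc
      m U = m (U ∩ K) + m (U \ K) := (measure_inter_add_sdiff U hK.measurableSet).symm
      _ ≤ r + m' (U \ K) :=
        add_le_add ((measure_mono inter_subset_right).trans (not_lt.1 hle)) (h _)
      _ < r + (m U - r) := ENNReal.add_lt_add_left (hr.ne_top) hd
      _ = m U := add_tsub_cancel_of_le hr.le
  exact lt_irrefl _ this

theorem regular_add_of_isFiniteMeasure {m m' : Measure Ω} [IsFiniteMeasure m] [IsFiniteMeasure m']
    [m.Regular] [m'.Regular] : (m + m').Regular := inferInstance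

end Aux

/-! ### The Banach space `M(Ω)` -/

section RegMeasure

/-- The linear space of complex regular Borel measures on `Ω`: those complex measures whose total
variation is a regular positive measure. -/
def regularComplexMeasures (Ω : Type*) [TopologicalSpace Ω] [T2Space Ω] [MeasurableSpace Ω]
    [BorelSpace Ω] : Submodule ℂ (ComplexMeasure Ω) where
  carrier := {μ | μ.variation.Regular}
  zero_mem' := by
    simp only [mem_ofPred_eq, VectorMeasure.variation_zero]
    infer_instance
  add_mem' := by
    intro μ ν hμ hν
    simp only [mem_ofPred_eq] at hμ hν ⊢
    have := regular_add_of_isFiniteMeasure (m := μ.variation) (m' := ν.variation)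
    exact regular_of_le_regular VectorMeasure.variation_add_le
  smul_mem' := by
    intro c μ hμ
    simp only [mem_ofPred_eq] at hμ ⊢
    rw [VectorMeasure.variation_smul]
    infer_instance

/-- `M(Ω)`. -/
abbrev RegMeasure (Ω : Type*) [TopologicalSpace Ω] [T2Space Ω] [MeasurableSpace Ω]
    [BorelSpace Ω] : Type _ := ↥(regularComplexMeasures Ω)

variable {Ω : Type*} [TopologicalSpace Ω] [T2Space Ω] [MeasurableSpace Ω] [BorelSpace Ω]

/-- The total variation measure `|μ|`. -/
def RegMeasure.abs (μ : RegMeasure Ω) : Measure Ω := (μ : ComplexMeasure Ω).variation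

instance (μ : RegMeasure Ω) : IsFiniteMeasure μ.abs :=
  isFiniteMeasure_variation_complexMeasure _

instance (μ : RegMeasure Ω) : μ.abs.Regular := μ.2

/-- The total variation norm `‖μ‖ = |μ|(Ω)`. -/
instance : NormedAddCommGroup (RegMeasure Ω) :=
  AddGroupNorm.toNormedAddCommGroup
    { toFun := fun μ => (μ.abs univ).toReal
      map_zero' := by simp [RegMeasure.abs]
      add_le' := by
        intro μ ν
        rw [← ENNReal.toReal_add (measure_ne_top _ _) (measure_ne_top _ _)]
        refine ENNReal.toReal_mono
          (ENNReal.add_ne_top.2 ⟨measure_ne_top _ _, measure_ne_top _ _⟩) ?_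
        exact (VectorMeasure.variation_add_le (μ := (μ : ComplexMeasure Ω)) (ν := ν)) univ
      neg' := by
        intro μ
        simp [RegMeasure.abs, VectorMeasure.variation_neg]
      eq_zero_of_map_eq_zero' := by
        intro μ h
        have h0 : μ.abs univ = 0 :=
          ((ENNReal.toReal_eq_zero_iff _).1 h).resolve_right (measure_ne_top _ _)
        exact Subtype.ext (VectorMeasure.variation_eq_zero.1 (Measure.measure_univ_eq_zero.1 h0)) }

theorem RegMeasure.norm_def (μ : RegMeasure Ω) : ‖μ‖ = (μ.abs univ).toReal := rfl

instance : NormedSpace ℂ (RegMeasure Ω) where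
  norm_smul_le c μ := by
    rw [RegMeasure.norm_def, RegMeasure.norm_def]
    apply le_of_eq
    have : (c • μ).abs = ‖c‖₊ • μ.abs := by
      simp only [RegMeasure.abs, Submodule.coe_smul]
      exact VectorMeasure.variation_smul
    rw [this, Measure.smul_apply, ENNReal.smul_def, smul_eq_mul, ENNReal.toReal_mul]
    simp

/-- The projection `P_X : M(Ω) → M(Ω)`, `P_X(μ)(E) = μ(X ∩ E)`, for a measurable set `X`
(for a set `X` that is not measurable it is the zero map). -/
def RegMeasure.proj (X : Set Ω) (μ : RegMeasure Ω) : RegMeasure Ω :=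
  ⟨(μ : ComplexMeasure Ω).restrict X,
    regular_of_le_regular (m' := μ.abs)
      ((VectorMeasure.variation_restrict_le).trans Measure.restrict_le_self)⟩

theorem RegMeasure.proj_apply {X : Set Ω} (hX : MeasurableSet X) (μ : RegMeasure Ω) {E : Set Ω}
    (hE : MeasurableSet E) :
    (μ.proj X : ComplexMeasure Ω) E = (μ : ComplexMeasure Ω) (X ∩ E) := by
  rw [inter_comm]
  exact VectorMeasure.restrict_apply _ hX hE

end RegMeasure

/-- `(X_1, …, X_n)` is a measurable partition of `Ω`: pairwise disjoint measurable sets with union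
`Ω`. As usual for ordered measurable partitions, some of the sets may be empty. -/
structure IsMeasurablePartition {Ω : Type*} [MeasurableSpace Ω] {n : ℕ} (X : Fin n → Set Ω) :
    Prop where
  measurableSet : ∀ i, MeasurableSet (X i)
  disjoint : Pairwise fun i j => Disjoint (X i) (X j)
  iUnion_eq : ⋃ i, X i = univ

end

/-!
Let `m` be a finite regular measure dominating the total variations of `μ_1, …, μ_n`, and write
`μ_i = f_i m` with `|f_i| ≤ 1`. If a seminorm `p` on `M(Ω)^n` satisfies
`p(a_1 ν, …, a_n ν) ≤ max |a_i| ‖ν‖`, then `F ↦ p(F_1 m, …, F_n m)` is subadditive and continuous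
on `L¹(m; ℂⁿ)` and is bounded by the norm on each `v 1_A`. As the `L¹` norm is additive on functions
with disjoint supports, it is bounded by the norm everywhere, so `p(μ) ≤ ∫ max |f_i| dm ≤ m(Ω)`.
Taking `m = ⋁ |μ_i|` shows that `‖⋁ |μ_i|‖` dominates every multi-norm.

The same bound holds for `p(μ) = ∑ |φ_i(μ_i)|` when `μ_{1,n}(φ) ≤ 1`, and `‖⋁ |μ_i|‖` equals
`∑ ‖P_{X_i} μ_i‖` for a partition on whose part `X_i` the density of `|μ_i|` is the largest.
Applied to `a_i μ_i` with `a_i = |φ_i(μ_i)|^{q-1}`, this yields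
`∑ |φ_i(μ_i)|^q ≤ ∑ |φ_i(μ_i)|^{q-1} ‖P_{X_i} μ_i‖`, and Young's inequality turns it into
`∑ |φ_i(μ_i)|^q ≤ ∑ ‖P_{X_i} μ_i‖^q`. Conversely, each `‖P_{X_i} μ_i‖` is attained at a functional
of norm at most one composed with `P_{X_i}`, and these functionals are admissible.
-/

section Density

variable {Ω : Type*} [MeasurableSpace Ω] {m : Measure Ω}

theorem norm_toLp_add_toLp_of_disjoint_support {E : Type*} [NormedAddCommGroup E] {f g : Ω → E}
    (hf : MemLp f 1 m) (hg : MemLp g 1 m) (hfg : Disjoint f.support g.support) :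
    ‖hf.toLp f + hg.toLp g‖ = ‖hf.toLp f‖ + ‖hg.toLp g‖ := by
  have enorm_add (x : Ω) : ‖f x + g x‖ₑ = ‖f x‖ₑ + ‖g x‖ₑ := by
    by_cases hx : f x = 0
    · simp [hx]
    · simp [Function.notMem_support.1 (disjoint_left.1 hfg hx)]
  rw [← MemLp.toLp_add, Lp.norm_toLp, Lp.norm_toLp, Lp.norm_toLp,
    ← ENNReal.toReal_add hf.2.ne hg.2.ne]
  simp only [eLpNorm_one_eq_lintegral_enorm, Pi.add_apply, enorm_add,
    lintegral_add_left' hf.1.enorm]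

theorem le_Lp_one_norm_of_indicatorConstLp_le {E : Type*} [NormedAddCommGroup E]
    {N : Lp E 1 m → ℝ} (hN : Continuous N) (add_le : ∀ F G, N (F + G) ≤ N F + N G)
    (indicator_le : ∀ (v : E) {s : Set Ω} (hs : MeasurableSet s) (hms : m s ≠ ∞),
      N (indicatorConstLp 1 hs hms v) ≤ ‖v‖ * m.real s)
    (F : Lp E 1 m) : N F ≤ ‖F‖ := by
  induction F using Lp.induction ENNReal.one_ne_top with
  | indicatorConst v hs hms =>
    rw [Lp.simpleFunc.coe_indicatorConst]
    refine (indicator_le v hs hms.ne).trans_eq ?_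
    simp [norm_indicatorConstLp]
  | add hf hg hfg ihf ihg =>
    rw [norm_toLp_add_toLp_of_disjoint_support hf hg hfg]
    exact (add_le _ _).trans (add_le_add ihf ihg)
  | isClosed => exact isClosed_le hN continuous_norm

theorem withDensityᵥ_complexMeasure_rnDeriv_eq [SigmaFinite m] {μ : ComplexMeasure Ω}
    (h : μ ≪ᵥ m.toENNRealVectorMeasure) : m.withDensityᵥ (μ.rnDeriv m) = μ := by
  obtain ⟨hre, him⟩ := (μ.absolutelyContinuous_ennreal_iff _).1 h
  have hint := μ.integrable_rnDeriv m
  ext E hE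
  rw [withDensityᵥ_apply hint hE]
  apply Complex.ext
  · rw [← RCLike.re_eq_complex_re, ← integral_re hint.integrableOn]
    change _ = ComplexMeasure.re μ E
    conv_rhs => rw [← SignedMeasure.withDensityᵥ_rnDeriv_eq _ _ hre,
      withDensityᵥ_apply (SignedMeasure.integrable_rnDeriv _ _) hE]
    rfl
  · rw [← RCLike.im_eq_complex_im, ← integral_im hint.integrableOn]
    change _ = ComplexMeasure.im μ E
    conv_rhs => rw [← SignedMeasure.withDensityᵥ_rnDeriv_eq _ _ him,
      withDensityᵥ_apply (SignedMeasure.integrable_rnDeriv _ _) hE]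
    rfl

theorem absolutelyContinuous_of_variation_le {E : Type*} [NormedAddCommGroup E]
    {μ : VectorMeasure Ω E} (h : μ.variation ≤ m) : μ ≪ᵥ m.toENNRealVectorMeasure := by
  refine VectorMeasure.AbsolutelyContinuous.mk fun s hs hms => ?_
  rw [Measure.toENNRealVectorMeasure_apply_measurable hs] at hms
  rw [← enorm_eq_zero, ← nonpos_iff_eq_zero, ← hms]
  exact (μ.enorm_measure_le_variation s).trans (h s)

theorem norm_complexMeasure_rnDeriv_le_one [SigmaFinite m] {μ : ComplexMeasure Ω}
    (h : μ.variation ≤ m) : ∀ᵐ x ∂m, ‖μ.rnDeriv m x‖ ≤ 1 := by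
  have hint := μ.integrable_rnDeriv m
  have density_eq : m.withDensity (fun x => ‖μ.rnDeriv m x‖ₑ) = μ.variation := by
    rw [← Measure.variation_withDensityᵥ hint,
      withDensityᵥ_complexMeasure_rnDeriv_eq (absolutelyContinuous_of_variation_le h)]
  have enorm_le : (fun x => ‖μ.rnDeriv m x‖ₑ) ≤ᵐ[m] 1 := by
    refine ae_le_of_forall_setLIntegral_le_of_sigmaFinite₀ hint.1.enorm fun s hs _ => ?_
    rw [← withDensity_apply _ hs, density_eq, Pi.one_def, setLIntegral_one]
    exact h s
  filter_upwards [enorm_le] with x hx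
  simpa [← ofReal_norm] using hx

theorem regular_withDensity [TopologicalSpace Ω] [T2Space Ω] [BorelSpace Ω] [IsFiniteMeasure m]
    [m.Regular] {f : Ω → ℝ≥0∞} (hf : ∫⁻ x, f x ∂m ≠ ∞) : (m.withDensity f).Regular := by
  have : IsFiniteMeasure (m.withDensity f) := isFiniteMeasure_withDensity hf
  have : (m.withDensity f).InnerRegularCompactLTTop := by
    refine ⟨fun A ⟨hA, _⟩ r hr => ?_⟩
    obtain ⟨δ, hδ, integral_lt⟩ :=
      exists_pos_setLIntegral_lt_of_measure_lt hf (tsub_pos_of_lt hr).ne'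
    obtain ⟨K, hKA, hK, hKδ⟩ := hA.exists_isCompact_sdiff_lt (measure_ne_top m A) hδ.ne'
    refine ⟨K, hKA, hK, ?_⟩
    have diff_lt : m.withDensity f (A \ K) < m.withDensity f A - r := by
      rw [withDensity_apply _ (hA.diff hK.measurableSet)]
      exact integral_lt _ hKδ
    calc r < m.withDensity f A - m.withDensity f (A \ K) := lt_tsub_comm.1 diff_lt
      _ ≤ m.withDensity f (A \ (A \ K)) := le_measure_sdiff
      _ = m.withDensity f K := by rw [sdiff_sdiff_cancel_left hKA]
  infer_instance

end Density

section Partition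

variable {Ω : Type*} [MeasurableSpace Ω] {n : ℕ}

namespace IsMeasurablePartition

theorem sum_restrict {X : Fin n → Set Ω} (hX : IsMeasurablePartition X) (m : Measure Ω) :
    ∑ i, m.restrict (X i) = m := by
  rw [← Measure.sum_fintype, ← Measure.restrict_iUnion hX.disjoint hX.measurableSet,
    hX.iUnion_eq, Measure.restrict_univ]

theorem sum_measureReal {X : Fin n → Set Ω} (hX : IsMeasurablePartition X) (m : Measure Ω)
    [IsFiniteMeasure m] : ∑ i, m.real (X i) = m.real univ := by
  rw [← hX.iUnion_eq, measureReal_iUnion_fintype hX.disjoint hX.measurableSet]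

end IsMeasurablePartition

theorem exists_isMeasurablePartition_forall_mem_le [NeZero n] {α : Type*} [LinearOrder α]
    [TopologicalSpace α] [OrderClosedTopology α] [SecondCountableTopology α] [MeasurableSpace α]
    [OpensMeasurableSpace α] {h : Fin n → Ω → α} (hh : ∀ i, Measurable (h i)) :
    ∃ X : Fin n → Set Ω, IsMeasurablePartition X ∧ ∀ j, ∀ x ∈ X j, ∀ i, h i x ≤ h j x := by
  refine ⟨fun j => {x | (∀ i, h i x ≤ h j x) ∧ ∀ i < j, h i x < h j x}, ⟨fun j => ?_, ?_, ?_⟩,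
    fun j x hx => hx.1⟩
  · simp only [ofPred_and, ofPred_forall]
    exact (MeasurableSet.iInter fun i => measurableSet_le (hh i) (hh j)).inter
      (MeasurableSet.iInter fun i => MeasurableSet.iInter fun _ => measurableSet_lt (hh i) (hh j))
  · refine (pairwise_disjoint_on _).2 fun i j hij => disjoint_left.2 fun x hxi hxj => ?_
    exact (hxj.2 i hij).not_ge (hxi.1 j)
  · refine eq_univ_of_forall fun x => mem_iUnion.2 ?_
    obtain ⟨k, hk⟩ := Finite.exists_max fun i => h i x
    obtain ⟨j, hj, hj_min⟩ := exists_minimal_of_wellFoundedLT (fun j => ∀ i, h i x ≤ h j x) ⟨k, hk⟩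
    refine ⟨j, hj, fun i hij => (hj i).lt_of_not_ge fun hji => ?_⟩
    exact hij.not_ge (hj_min (fun l => (hj l).trans hji) hij.le)

theorem exists_isMeasurablePartition_iSup_le [NeZero n] (ν : Fin n → Measure Ω)
    [∀ i, IsFiniteMeasure (ν i)] :
    ∃ X : Fin n → Set Ω, IsMeasurablePartition X ∧ ⨆ i, ν i ≤ ∑ i, (ν i).restrict (X i) := by
  let m : Measure Ω := ∑ i, ν i
  have density (i : Fin n) : m.withDensity ((ν i).rnDeriv m) = ν i :=
    Measure.withDensity_rnDeriv_eq _ _ <| Measure.absolutelyContinuous_of_le <|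
      Finset.single_le_sum (f := ν) (fun _ _ => Measure.zero_le _) (Finset.mem_univ i)
  obtain ⟨X, hX, le_on⟩ := exists_isMeasurablePartition_forall_mem_le
    fun i => (ν i).measurable_rnDeriv m
  refine ⟨X, hX, iSup_le fun i => ?_⟩
  rw [← hX.sum_restrict (ν i)]
  refine Finset.sum_le_sum fun j _ => ?_
  rw [← density i, ← density j, restrict_withDensity (hX.measurableSet j),
    restrict_withDensity (hX.measurableSet j)]
  exact withDensity_mono (ae_restrict_of_forall_mem (hX.measurableSet j) fun x hx => le_on j x hx i)

end Partition

section CoordinateSeminorm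

variable {𝕜 E ι : Type*} [NontriviallyNormedField 𝕜] [NormedAddCommGroup E] [NormedSpace 𝕜 E]
  [Fintype ι]

theorem seminorm_le_sum_norm {p : Seminorm 𝕜 (ι → E)}
    (hp : ∀ (a : ι → 𝕜) (x : E), p (fun i => a i • x) ≤ ‖a‖ * ‖x‖) (x : ι → E) :
    p x ≤ ∑ i, ‖x i‖ := by
  classical
  have p_single_le (i : ι) : p (Pi.single i (x i)) ≤ ‖x i‖ := by
    have h := hp (Pi.single i 1) (x i)
    rw [Pi.norm_single, norm_one, one_mul] at h
    convert h using 2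
    ext j
    simp [Pi.single_apply, ite_smul]
  calc p x = p (∑ i, Pi.single i (x i)) := by rw [Finset.univ_sum_single]
    _ ≤ ∑ i, p (Pi.single i (x i)) :=
      Finset.le_sum_of_subadditive p (map_zero p).le (map_add_le_add p) _ _
    _ ≤ ∑ i, ‖x i‖ := Finset.sum_le_sum fun i _ => p_single_le i

theorem continuous_seminorm_of_smul_const_le {p : Seminorm 𝕜 (ι → E)}
    (hp : ∀ (a : ι → 𝕜) (x : E), p (fun i => a i • x) ≤ ‖a‖ * ‖x‖) : Continuous p := by
  let q : Seminorm 𝕜 (ι → E) := ∑ i, (normSeminorm 𝕜 E).comp (LinearMap.proj i)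
  have q_apply (x : ι → E) : q x = ∑ i, ‖x i‖ := by simp [q]
  refine Seminorm.continuous_of_le (q := q) ?_ fun x => ?_
  · rw [funext q_apply]
    fun_prop
  · rw [q_apply]
    exact seminorm_le_sum_norm hp x

end CoordinateSeminorm

section RegMeasureDensity

variable {Ω ι : Type*} [TopologicalSpace Ω] [T2Space Ω] [MeasurableSpace Ω] [BorelSpace Ω]
  [Fintype ι]

namespace RegMeasure

/-- The isometric embedding `f ↦ f m` of `L¹(m)` into `M(Ω)`. -/
noncomputable def withDensity (m : Measure Ω) [IsFiniteMeasure m] [m.Regular] :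
    (Ω →₁[m] ℂ) →ₗᵢ[ℂ] RegMeasure Ω where
  toFun f := ⟨m.withDensityᵥ f, by
    have hf := L1.integrable_coeFn f
    change Measure.Regular (VectorMeasure.variation _)
    rw [Measure.variation_withDensityᵥ hf]
    exact regular_withDensity hf.2.ne⟩
  map_add' f g := Subtype.ext <|
    (WithDensityᵥEq.congr_ae (Lp.coeFn_add f g)).trans
      (withDensityᵥ_add (L1.integrable_coeFn f) (L1.integrable_coeFn g))
  map_smul' c f := Subtype.ext <|
    (WithDensityᵥEq.congr_ae (Lp.coeFn_smul c f)).trans (withDensityᵥ_smul f c)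
  norm_map' f := by
    change ((m.withDensityᵥ f).variation univ).toReal = ‖f‖
    rw [Measure.variation_withDensityᵥ (L1.integrable_coeFn f), L1.norm_def,
      withDensity_apply _ MeasurableSet.univ, Measure.restrict_univ]

/-- The operator `f ↦ (f_i m)_i` from `L¹(m; ℂ^ι)` to `M(Ω)^ι`. -/
noncomputable def withDensityPi (m : Measure Ω) [IsFiniteMeasure m] [m.Regular] :
    (Ω →₁[m] (ι → ℂ)) →L[ℂ] (ι → RegMeasure Ω) :=
  ContinuousLinearMap.pi fun i => (withDensity m).toContinuousLinearMap ∘L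
    (ContinuousLinearMap.proj (R := ℂ) (φ := fun _ : ι => ℂ) i).compLpL 1 m

variable {m : Measure Ω} [IsFiniteMeasure m] [m.Regular]

theorem coe_withDensity (f : Ω →₁[m] ℂ) :
    (withDensity m f : ComplexMeasure Ω) = m.withDensityᵥ f := rfl

theorem coe_withDensityPi_apply (f : Ω →₁[m] (ι → ℂ)) (i : ι) :
    (withDensityPi m f i : ComplexMeasure Ω) = m.withDensityᵥ fun x => f x i :=
  WithDensityᵥEq.congr_ae <| ContinuousLinearMap.coeFn_compLpL _ f

theorem withDensityPi_indicatorConstLp (v : ι → ℂ) {s : Set Ω} (hs : MeasurableSet s)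
    (hms : m s ≠ ∞) : withDensityPi m (indicatorConstLp 1 hs hms v) =
      fun i => v i • withDensity m (indicatorConstLp 1 hs hms 1) := by
  ext1 i
  apply Subtype.ext
  rw [coe_withDensityPi_apply, Submodule.coe_smul, coe_withDensity, ← withDensityᵥ_smul]
  apply WithDensityᵥEq.congr_ae
  filter_upwards [indicatorConstLp_coeFn (hs := hs) (hμs := hms) (c := v) (p := 1),
    indicatorConstLp_coeFn (hs := hs) (hμs := hms) (c := (1 : ℂ)) (p := 1)] with x hv h1
  rw [hv, Pi.smul_apply, h1]
  by_cases hx : x ∈ s <;> simp [hx]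

theorem seminorm_withDensityPi_le {p : Seminorm ℂ (ι → RegMeasure Ω)}
    (hp : ∀ (a : ι → ℂ) (ν : RegMeasure Ω), p (fun i => a i • ν) ≤ ‖a‖ * ‖ν‖)
    (f : Ω →₁[m] (ι → ℂ)) : p (withDensityPi m f) ≤ ‖f‖ := by
  refine le_Lp_one_norm_of_indicatorConstLp_le (N := fun f => p (withDensityPi m f))
    ((continuous_seminorm_of_smul_const_le hp).comp (withDensityPi m).continuous)
    (fun f g => ?_) (fun v s hs hms => ?_) f
  · rw [map_add]
    exact map_add_le_add p _ _
  · rw [withDensityPi_indicatorConstLp]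
    refine (hp v _).trans_eq ?_
    simp [norm_indicatorConstLp]

theorem exists_withDensityPi_eq_of_abs_le {μ : ι → RegMeasure Ω} (hμ : ∀ i, (μ i).abs ≤ m) :
    ∃ f : Ω →₁[m] (ι → ℂ), withDensityPi m f = μ ∧ ‖f‖ ≤ m.real univ := by
  let f (x : Ω) (i : ι) : ℂ := (μ i : ComplexMeasure Ω).rnDeriv m x
  have hf : Integrable f m := Integrable.of_eval fun i => ComplexMeasure.integrable_rnDeriv _ _
  have norm_f_le : ∀ᵐ x ∂m, ‖f x‖ ≤ 1 := by
    filter_upwards [ae_all_iff.2 fun i => norm_complexMeasure_rnDeriv_le_one (hμ i)] with x hx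
    exact (pi_norm_le_iff_of_nonneg zero_le_one).2 hx
  refine ⟨hf.toL1 f, funext fun i => Subtype.ext ?_, ?_⟩
  · rw [coe_withDensityPi_apply, ← withDensityᵥ_complexMeasure_rnDeriv_eq
      (absolutelyContinuous_of_variation_le (hμ i))]
    apply WithDensityᵥEq.congr_ae
    filter_upwards [hf.coeFn_toL1] with x hx
    rw [hx]
  · rw [L1.norm_of_fun_eq_integral_norm]
    refine (integral_mono_ae hf.norm (integrable_const 1) norm_f_le).trans_eq ?_
    simp

theorem seminorm_le_measureReal {p : Seminorm ℂ (ι → RegMeasure Ω)}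
    (hp : ∀ (a : ι → ℂ) (ν : RegMeasure Ω), p (fun i => a i • ν) ≤ ‖a‖ * ‖ν‖)
    {μ : ι → RegMeasure Ω} (hμ : ∀ i, (μ i).abs ≤ m) : p μ ≤ m.real univ := by
  obtain ⟨f, rfl, hf⟩ := exists_withDensityPi_eq_of_abs_le hμ
  exact (seminorm_withDensityPi_le hp f).trans hf

end RegMeasure

end RegMeasureDensity

section LatticeNorm

variable {Ω ι : Type*} [TopologicalSpace Ω] [T2Space Ω] [MeasurableSpace Ω] [BorelSpace Ω]

namespace RegMeasure

theorem abs_add_le (μ ν : RegMeasure Ω) : (μ + ν).abs ≤ μ.abs + ν.abs :=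
  VectorMeasure.variation_add_le

theorem abs_smul (c : ℂ) (μ : RegMeasure Ω) : (c • μ).abs = ‖c‖₊ • μ.abs :=
  VectorMeasure.variation_smul (μ := (μ : ComplexMeasure Ω))

theorem abs_zero : (0 : RegMeasure Ω).abs = 0 :=
  VectorMeasure.variation_zero

theorem eq_zero_of_abs_eq_zero {μ : RegMeasure Ω} (h : μ.abs = 0) : μ = 0 :=
  Subtype.ext (VectorMeasure.variation_eq_zero.1 h)

theorem abs_le_iSup_abs (μ : ι → RegMeasure Ω) (i : ι) : (μ i).abs ≤ ⨆ i, (μ i).abs :=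
  le_iSup (fun i => (μ i).abs) i

theorem measureReal_iSup_abs_le {μ : ι → RegMeasure Ω} {m : Measure Ω} [IsFiniteMeasure m]
    (h : ∀ i, (μ i).abs ≤ m) : (⨆ i, (μ i).abs).real univ ≤ m.real univ :=
  ENNReal.toReal_mono (measure_ne_top m univ) (iSup_le (a := m) h univ)

theorem iSup_abs_le_sum [Fintype ι] (μ : ι → RegMeasure Ω) : ⨆ i, (μ i).abs ≤ ∑ i, (μ i).abs :=
  iSup_le fun i => Finset.single_le_sum (f := fun i => (μ i).abs)
    (fun _ _ => Measure.zero_le _) (Finset.mem_univ i)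

instance [Finite ι] (μ : ι → RegMeasure Ω) : IsFiniteMeasure (⨆ i, (μ i).abs) := by
  cases nonempty_fintype ι
  exact isFiniteMeasure_of_le _ (iSup_abs_le_sum μ)

instance [Finite ι] (μ : ι → RegMeasure Ω) : (⨆ i, (μ i).abs).Regular := by
  cases nonempty_fintype ι
  have sum_regular : (∑ i, (μ i).abs).Regular :=
    (Finset.sum_induction (fun i => (μ i).abs) (fun m => IsFiniteMeasure m ∧ m.Regular)
      (fun m m' ⟨_, _⟩ ⟨_, _⟩ => ⟨inferInstance, inferInstance⟩) ⟨inferInstance, inferInstance⟩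
      fun i _ => ⟨inferInstance, inferInstance⟩).2
  exact regular_of_le_regular (iSup_abs_le_sum μ)

theorem measureReal_iSup_abs_add_le [Finite ι] (μ ν : ι → RegMeasure Ω) :
    (⨆ i, ((μ + ν) i).abs).real univ ≤
      (⨆ i, (μ i).abs).real univ + (⨆ i, (ν i).abs).real univ := by
  rw [← measureReal_add_apply]
  exact measureReal_iSup_abs_le fun i =>
    (abs_add_le _ _).trans (add_le_add (abs_le_iSup_abs μ i) (abs_le_iSup_abs ν i))

variable [Fintype ι]

theorem measureReal_iSup_abs_smul_le (a : ι → ℂ) (μ : ι → RegMeasure Ω) :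
    (⨆ i, (a i • μ i).abs).real univ ≤ ‖a‖ * (⨆ i, (μ i).abs).real univ := by
  rw [← coe_nnnorm, ← measureReal_nnreal_smul_apply]
  refine measureReal_iSup_abs_le fun i => ?_
  rw [abs_smul]
  refine Measure.le_iff.2 fun s _ => ?_
  rw [Measure.smul_apply, Measure.smul_apply]
  exact smul_le_smul (nnnorm_le_pi_nnnorm a i) (abs_le_iSup_abs μ i s) zero_le zero_le

/-- The norm `μ ↦ ‖⋁ i, |μ i|‖` on finite families in `M(Ω)`, the total mass of the least upper
bound of the total variations, bundled as a seminorm. -/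
noncomputable def latticeNorm : Seminorm ℂ (ι → RegMeasure Ω) :=
  Seminorm.ofSMulLE (fun μ => (⨆ i, (μ i).abs).real univ)
    (le_antisymm
      ((measureReal_iSup_abs_le (m := 0) fun _ => abs_zero.le).trans_eq (measureReal_zero_apply _))
      measureReal_nonneg)
    measureReal_iSup_abs_add_le
    (fun c μ => (measureReal_iSup_abs_smul_le (fun _ => c) μ).trans <|
      mul_le_mul_of_nonneg_right (pi_norm_const_le c) measureReal_nonneg)

theorem latticeNorm_apply (μ : ι → RegMeasure Ω) :
    latticeNorm μ = (⨆ i, (μ i).abs).real univ := rfl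

theorem latticeNorm_pi_smul_le (a : ι → ℂ) (μ : ι → RegMeasure Ω) :
    latticeNorm (fun i => a i • μ i) ≤ ‖a‖ * latticeNorm μ :=
  measureReal_iSup_abs_smul_le a μ

theorem eq_zero_of_latticeNorm_eq_zero {μ : ι → RegMeasure Ω} (h : latticeNorm μ = 0) : μ = 0 := by
  rw [latticeNorm_apply, measureReal_eq_zero_iff, Measure.measure_univ_eq_zero] at h
  ext1 i
  exact eq_zero_of_abs_eq_zero (le_antisymm (h ▸ abs_le_iSup_abs μ i) (Measure.zero_le _))

theorem seminorm_le_latticeNorm {p : Seminorm ℂ (ι → RegMeasure Ω)}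
    (hp : ∀ (a : ι → ℂ) (ν : RegMeasure Ω), p (fun i => a i • ν) ≤ ‖a‖ * ‖ν‖) :
    p ≤ latticeNorm :=
  fun μ => seminorm_le_measureReal hp (abs_le_iSup_abs μ)

end RegMeasure

end LatticeNorm

section MaximumMultiNorm

theorem iSup_snoc {α : Type*} [CompleteLattice α] {n : ℕ} (f : Fin n → α) (a : α) :
    ⨆ i, (Fin.snoc f a : Fin (n + 1) → α) i = (⨆ i, f i) ⊔ a := by
  refine le_antisymm (iSup_le fun i => ?_) (sup_le (iSup_le fun i => ?_) ?_)
  · refine Fin.lastCases ?_ (fun j => ?_) i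
    · rw [Fin.snoc_last]
      exact le_sup_right
    · rw [Fin.snoc_castSucc]
      exact le_sup_of_le_left (le_iSup f j)
  · exact le_iSup_of_le i.castSucc (Fin.snoc_castSucc (α := fun _ => α) a f i).ge
  · exact le_iSup_of_le (Fin.last n) (Fin.snoc_last (α := fun _ => α) a f).ge

namespace IsMultiNorm

variable {E : Type*} [NormedAddCommGroup E] [NormedSpace ℂ E] {N : (n : ℕ) → (Fin n → E) → ℝ}

theorem const (hN : IsMultiNorm N) (n : ℕ) (x : E) : N (n + 1) (fun _ => x) = ‖x‖ := by
  induction n with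
  | zero => exact hN.one x
  | succ n ih =>
    rw [← ih, ← hN.snoc_last n fun _ => x]
    congr 1
    ext i
    refine Fin.lastCases ?_ (fun j => ?_) i <;> simp

theorem smul_const_le (hN : IsMultiNorm N) {n : ℕ} (hn : 1 ≤ n) (a : Fin n → ℂ) (x : E) :
    N n (fun i => a i • x) ≤ ‖a‖ * ‖x‖ := by
  obtain ⟨n, rfl⟩ := Nat.exists_eq_add_of_le' hn
  obtain rfl | hn_pos := Nat.eq_zero_or_pos n
  · have family_eq : (fun i => a i • x) = fun _ : Fin 1 => a 0 • x := by
      ext1 i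
      rw [Fin.fin_one_eq_zero i]
    rw [family_eq, hN.one, norm_smul]
    gcongr
    exact norm_le_pi_norm a 0
  · rw [← hN.const n x]
    exact hN.smul_le _ (by omega) a _

/-- The `n`-th norm of a multi-norm, as a seminorm on `E^n`. -/
noncomputable def toSeminorm (hN : IsMultiNorm N) {n : ℕ} (hn : 1 ≤ n) :
    Seminorm ℂ (Fin n → E) :=
  Seminorm.of (N n) (hN.add_le n hn) (hN.smul n hn)

end IsMultiNorm

namespace RegMeasure

variable {Ω : Type*} [TopologicalSpace Ω] [T2Space Ω] [MeasurableSpace Ω] [BorelSpace Ω]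

theorem iSup_abs_snoc {n : ℕ} (μ : Fin n → RegMeasure Ω) (ν : RegMeasure Ω) :
    ⨆ i, (Fin.snoc (α := fun _ => RegMeasure Ω) μ ν i).abs = (⨆ i, (μ i).abs) ⊔ ν.abs := by
  rw [← iSup_snoc]
  exact congrArg iSup (Fin.comp_snoc RegMeasure.abs μ ν)

theorem isMultiNorm_latticeNorm :
    IsMultiNorm (E := RegMeasure Ω) fun _ μ => latticeNorm μ where
  add_le _ _ := map_add_le_add _
  smul _ _ := map_smul_eq_mul _
  eq_zero _ _ _ := eq_zero_of_latticeNorm_eq_zero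
  one μ := by
    rw [latticeNorm_apply, ciSup_const]
    rfl
  perm _ _ σ μ := congrArg (Measure.real · univ) (σ.iSup_comp (g := fun i => (μ i).abs))
  smul_le _ _ := latticeNorm_pi_smul_le
  snoc_zero _ _ μ := by
    rw [latticeNorm_apply, latticeNorm_apply, iSup_abs_snoc, abs_zero,
      sup_eq_left.2 (Measure.zero_le _)]
  snoc_last _ μ := by
    rw [latticeNorm_apply, latticeNorm_apply, iSup_abs_snoc, sup_eq_left.2 (abs_le_iSup_abs μ _)]

theorem isMaximumMultiNorm_latticeNorm :
    IsMaximumMultiNorm (E := RegMeasure Ω) fun _ μ => latticeNorm μ :=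
  ⟨isMultiNorm_latticeNorm, fun _ hN _ hn μ =>
    seminorm_le_latticeNorm (p := hN.toSeminorm hn) (hN.smul_const_le hn) μ⟩

end RegMeasure

end MaximumMultiNorm

section WeakSummingNorm

variable {E : Type*} [NormedAddCommGroup E] [NormedSpace ℂ E] {n : ℕ}
  {φ : Fin n → StrongDual ℂ E}

theorem sum_norm_apply_le_of_weakSummingNorm_le_one (h : weakSummingNorm 1 φ ≤ 1) (e : E) :
    ∑ i, ‖φ i e‖ ≤ ‖e‖ := by
  obtain rfl | he := eq_or_ne e 0
  · simp
  have norm_pos : 0 < ‖e‖ := norm_pos_iff.2 he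
  let u : E := (‖e‖⁻¹ : ℂ) • e
  have double_dual_norm_le : ‖NormedSpace.inclusionInDoubleDual ℂ E u‖ ≤ 1 :=
    (NormedSpace.double_dual_bound ℂ E u).trans_eq (norm_smul_inv_norm he)
  have sum_norm_apply_u : ∑ i, ‖φ i u‖ = (∑ i, ‖φ i e‖) / ‖e‖ := by
    simp only [u, map_smul, norm_smul, norm_inv, Complex.norm_real, norm_norm, ← Finset.mul_sum,
      div_eq_inv_mul]
  have bddAbove : BddAbove {r : ℝ | ∃ Φ : StrongDual ℂ (StrongDual ℂ E), ‖Φ‖ ≤ 1 ∧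
      r = (∑ i, ‖Φ (φ i)‖ ^ (1 : ℝ)) ^ (1 / (1 : ℝ))} := by
    refine ⟨∑ i, ‖φ i‖, ?_⟩
    rintro r ⟨Ψ, hΨ, rfl⟩
    simp only [Real.rpow_one, div_one]
    exact Finset.sum_le_sum fun i _ => Ψ.le_of_opNorm_le_of_le hΨ le_rfl |>.trans_eq (one_mul _)
  refine (div_le_one norm_pos).1 (le_trans (le_csSup bddAbove ⟨_, double_dual_norm_le, ?_⟩) h)
  simp only [Real.rpow_one, div_one, NormedSpace.dual_def, sum_norm_apply_u]

theorem norm_sum_smul_le_of_sum_norm_apply_le (h : ∀ e, ∑ i, ‖φ i e‖ ≤ ‖e‖) {c : Fin n → ℂ}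
    (hc : ∀ i, ‖c i‖ = 1) : ‖∑ i, c i • φ i‖ ≤ 1 := by
  refine ContinuousLinearMap.opNorm_le_bound _ zero_le_one fun e => ?_
  calc ‖(∑ i, c i • φ i) e‖ = ‖∑ i, c i • φ i e‖ := by simp
    _ ≤ ∑ i, ‖c i • φ i e‖ := norm_sum_le _ _
    _ = ∑ i, ‖φ i e‖ := by simp only [norm_smul, hc, one_mul]
    _ ≤ 1 * ‖e‖ := (h e).trans_eq (one_mul _).symm

theorem weakSummingNorm_le_one_of_sum_norm_apply_le (h : ∀ e, ∑ i, ‖φ i e‖ ≤ ‖e‖) :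
    weakSummingNorm 1 φ ≤ 1 := by
  refine csSup_le ⟨_, 0, by simp, rfl⟩ ?_
  rintro r ⟨Φ, hΦ, rfl⟩
  choose c hc hcΦ using fun i => RCLike.exists_norm_eq_mul_self (Φ (φ i))
  have sum_eq : ((∑ i, ‖Φ (φ i)‖ : ℝ) : ℂ) = Φ (∑ i, c i • φ i) := by
    rw [map_sum, Complex.ofReal_sum]
    refine Finset.sum_congr rfl fun i _ => ?_
    rw [map_smul, smul_eq_mul]
    exact hcΦ i
  calc (∑ i, ‖Φ (φ i)‖ ^ (1 : ℝ)) ^ (1 / (1 : ℝ)) = ∑ i, ‖Φ (φ i)‖ := by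
        simp only [Real.rpow_one, div_one]
    _ = ‖Φ (∑ i, c i • φ i)‖ := by
        rw [← sum_eq, Complex.norm_of_nonneg (Finset.sum_nonneg fun _ _ => norm_nonneg _)]
    _ ≤ 1 * 1 := Φ.le_of_opNorm_le_of_le hΦ (norm_sum_smul_le_of_sum_norm_apply_le h hc)
    _ = 1 := one_mul 1

theorem weakSummingNorm_one_le_one_iff :
    weakSummingNorm 1 φ ≤ 1 ↔ ∀ e, ∑ i, ‖φ i e‖ ≤ ‖e‖ :=
  ⟨sum_norm_apply_le_of_weakSummingNorm_le_one, weakSummingNorm_le_one_of_sum_norm_apply_le⟩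

end WeakSummingNorm

section Young

theorem rpow_sub_one_mul_le {b c q : ℝ} (hb : 0 ≤ b) (hc : 0 ≤ c) (hq : 1 ≤ q) :
    b ^ (q - 1) * c ≤ (1 - 1 / q) * b ^ q + 1 / q * c ^ q := by
  have q_pos : 0 < q := one_pos.trans_le hq
  have b_rpow : (b ^ q) ^ (1 - 1 / q) = b ^ (q - 1) := by
    rw [← Real.rpow_mul hb, mul_sub, mul_one, mul_one_div_cancel q_pos.ne']
  have c_rpow : (c ^ q) ^ (1 / q) = c := by rw [one_div, Real.rpow_rpow_inv hc q_pos.ne']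
  rw [← b_rpow, ← congrArg (_ * ·) c_rpow]
  exact Real.geom_mean_le_arith_mean2_weighted
    (sub_nonneg.2 ((div_le_one q_pos).2 hq)) (by positivity) (Real.rpow_nonneg hb q)
    (Real.rpow_nonneg hc q) (sub_add_cancel 1 (1 / q))

theorem sum_rpow_le_sum_rpow_of_le_sum_rpow_sub_one_mul {ι : Type*} {s : Finset ι} {b c : ι → ℝ}
    {q : ℝ} (hq : 1 ≤ q) (hb : ∀ i, 0 ≤ b i) (hc : ∀ i, 0 ≤ c i)
    (h : ∑ i ∈ s, b i ^ q ≤ ∑ i ∈ s, b i ^ (q - 1) * c i) :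
    ∑ i ∈ s, b i ^ q ≤ ∑ i ∈ s, c i ^ q := by
  have young : ∑ i ∈ s, b i ^ q ≤
      (1 - 1 / q) * ∑ i ∈ s, b i ^ q + 1 / q * ∑ i ∈ s, c i ^ q := by
    refine h.trans ?_
    rw [Finset.mul_sum, Finset.mul_sum, ← Finset.sum_add_distrib]
    exact Finset.sum_le_sum fun i _ => rpow_sub_one_mul_le (hb i) (hc i) hq
  have q_inv_pos : 0 < 1 / q := one_div_pos.2 (one_pos.trans_le hq)
  refine le_of_mul_le_mul_left ?_ q_inv_pos
  linarith

end Young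

section WeakMultiNorm

variable {Ω ι : Type*} [TopologicalSpace Ω] [T2Space Ω] [MeasurableSpace Ω] [BorelSpace Ω]

namespace RegMeasure

theorem norm_proj {X : Set Ω} (hX : MeasurableSet X) (μ : RegMeasure Ω) :
    ‖μ.proj X‖ = μ.abs.real X := by
  change (μ.proj X).abs.real univ = μ.abs.real X
  have abs_proj : (μ.proj X).abs = μ.abs.restrict X := VectorMeasure.variation_restrict hX
  rw [abs_proj, measureReal_restrict_apply_univ]

theorem norm_proj_le {X : Set Ω} (hX : MeasurableSet X) (μ : RegMeasure Ω) : ‖μ.proj X‖ ≤ ‖μ‖ := by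
  rw [norm_proj hX]
  exact measureReal_mono (subset_univ X)

/-- The projection `P_X` of `M(Ω)` as a bounded operator. -/
noncomputable def projL {X : Set Ω} (hX : MeasurableSet X) : RegMeasure Ω →L[ℂ] RegMeasure Ω :=
  LinearMap.mkContinuous
    { toFun := proj X
      map_add' := fun _ _ => Subtype.ext (VectorMeasure.restrict_add _ _ X)
      map_smul' := fun _ _ => Subtype.ext (VectorMeasure.restrict_smul _) }
    1 fun μ => (norm_proj_le hX μ).trans_eq (one_mul _).symm

theorem projL_apply {X : Set Ω} (hX : MeasurableSet X) (μ : RegMeasure Ω) :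
    projL hX μ = μ.proj X := rfl

theorem norm_proj_smul {X : Set Ω} (hX : MeasurableSet X) (c : ℂ) (μ : RegMeasure Ω) :
    ‖(c • μ).proj X‖ = ‖c‖ * ‖μ.proj X‖ := by
  rw [← projL_apply hX, map_smul, norm_smul, projL_apply]

theorem sum_norm_apply_le_latticeNorm [Fintype ι] {φ : ι → StrongDual ℂ (RegMeasure Ω)}
    (hφ : ∀ ν, ∑ i, ‖φ i ν‖ ≤ ‖ν‖) (μ : ι → RegMeasure Ω) :
    ∑ i, ‖φ i (μ i)‖ ≤ latticeNorm μ := by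
  let p : Seminorm ℂ (ι → RegMeasure Ω) :=
    ∑ i, (normSeminorm ℂ ℂ).comp ((φ i).toLinearMap ∘ₗ LinearMap.proj i)
  have p_apply (μ : ι → RegMeasure Ω) : p μ = ∑ i, ‖φ i (μ i)‖ := by simp [p]
  rw [← p_apply]
  refine seminorm_le_latticeNorm (p := p) (fun a ν => ?_) μ
  calc p (fun i => a i • ν) = ∑ i, ‖a i‖ * ‖φ i ν‖ := by simp only [p_apply, map_smul, norm_smul]
    _ ≤ ∑ i, ‖a‖ * ‖φ i ν‖ := by
        gcongr with i
        exact norm_le_pi_norm a i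
    _ ≤ ‖a‖ * ‖ν‖ := by
        rw [← Finset.mul_sum]
        gcongr
        exact hφ ν

theorem exists_isMeasurablePartition_latticeNorm_le {n : ℕ} [NeZero n] (μ : Fin n → RegMeasure Ω) :
    ∃ X : Fin n → Set Ω, IsMeasurablePartition X ∧
      latticeNorm μ ≤ ∑ i, ‖(μ i).proj (X i)‖ := by
  obtain ⟨X, hX, iSup_le⟩ := exists_isMeasurablePartition_iSup_le fun i => (μ i).abs
  refine ⟨X, hX, ?_⟩
  calc latticeNorm μ ≤ (∑ i, (μ i).abs.restrict (X i)).real univ :=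
        ENNReal.toReal_mono (measure_ne_top _ univ) (iSup_le univ)
    _ = ∑ i, ‖(μ i).proj (X i)‖ := by
        rw [measureReal_def, Measure.finsetSum_apply,
          ENNReal.toReal_sum fun _ _ => measure_ne_top _ _]
        simp only [Measure.restrict_apply_univ, norm_proj (hX.measurableSet _), measureReal_def]

theorem exists_isMeasurablePartition_sum_rpow_le {n : ℕ} [NeZero n] {q : ℝ} (hq : 1 ≤ q)
    {φ : Fin n → StrongDual ℂ (RegMeasure Ω)} (hφ : ∀ ν, ∑ i, ‖φ i ν‖ ≤ ‖ν‖)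
    (μ : Fin n → RegMeasure Ω) :
    ∃ X : Fin n → Set Ω, IsMeasurablePartition X ∧
      ∑ i, ‖φ i (μ i)‖ ^ q ≤ ∑ i, ‖(μ i).proj (X i)‖ ^ q := by
  let a (i : Fin n) : ℂ := (‖φ i (μ i)‖ ^ (q - 1) : ℝ)
  have norm_a (i : Fin n) : ‖a i‖ = ‖φ i (μ i)‖ ^ (q - 1) :=
    Complex.norm_of_nonneg (Real.rpow_nonneg (norm_nonneg _) _)
  obtain ⟨X, hX, latticeNorm_le⟩ :=
    exists_isMeasurablePartition_latticeNorm_le fun i => a i • μ i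
  refine ⟨X, hX, sum_rpow_le_sum_rpow_of_le_sum_rpow_sub_one_mul hq (fun _ => norm_nonneg _)
    (fun _ => norm_nonneg _) ?_⟩
  calc ∑ i, ‖φ i (μ i)‖ ^ q = ∑ i, ‖φ i (a i • μ i)‖ := by
        refine Finset.sum_congr rfl fun i _ => ?_
        rw [map_smul, norm_smul, norm_a,
          ← Real.rpow_add_one' (norm_nonneg _) (by linarith), sub_add_cancel]
    _ ≤ latticeNorm fun i => a i • μ i := sum_norm_apply_le_latticeNorm hφ _
    _ ≤ ∑ i, ‖(a i • μ i).proj (X i)‖ := latticeNorm_le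
    _ = ∑ i, ‖φ i (μ i)‖ ^ (q - 1) * ‖(μ i).proj (X i)‖ := by
        simp only [norm_proj_smul (hX.measurableSet _), norm_a]

end RegMeasure

namespace IsMeasurablePartition

variable {n : ℕ} {X : Fin n → Set Ω}

theorem sum_norm_proj (hX : IsMeasurablePartition X) (μ : RegMeasure Ω) :
    ∑ i, ‖μ.proj (X i)‖ = ‖μ‖ := by
  simp only [RegMeasure.norm_proj (hX.measurableSet _)]
  exact hX.sum_measureReal μ.abs

theorem exists_sum_norm_apply_le_and_norm_apply_eq (hX : IsMeasurablePartition X)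
    (μ : Fin n → RegMeasure Ω) :
    ∃ φ : Fin n → StrongDual ℂ (RegMeasure Ω), (∀ ν, ∑ i, ‖φ i ν‖ ≤ ‖ν‖) ∧
      ∀ i, ‖φ i (μ i)‖ = ‖(μ i).proj (X i)‖ := by
  choose ψ ψ_norm_le ψ_apply using fun i => exists_dual_vector'' ℂ ((μ i).proj (X i))
  refine ⟨fun i => (ψ i).comp (RegMeasure.projL (hX.measurableSet i)), fun ν => ?_, fun i => ?_⟩
  · rw [← hX.sum_norm_proj ν]
    exact Finset.sum_le_sum fun i _ =>
      ((ψ i).le_of_opNorm_le (ψ_norm_le i) _).trans_eq (one_mul _)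
  · rw [ContinuousLinearMap.comp_apply, RegMeasure.projL_apply, ψ_apply]
    exact RCLike.norm_of_nonneg (norm_nonneg _)

end IsMeasurablePartition

theorem isLUB_weakMultiNorm_one {q : ℝ} (hq : 1 ≤ q) {n : ℕ} [NeZero n]
    (μ : Fin n → RegMeasure Ω) :
    IsLUB {r : ℝ | ∃ X : Fin n → Set Ω, IsMeasurablePartition X ∧
        r = (∑ i, ‖(μ i).proj (X i)‖ ^ q) ^ (1 / q)}
      (weakMultiNorm 1 q μ) := by
  have q_nonneg : 0 ≤ q := zero_le_one.trans hq
  have rpow_mono {b c : Fin n → ℝ} (hb : ∀ i, 0 ≤ b i) (h : ∑ i, b i ^ q ≤ ∑ i, c i ^ q) :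
      (∑ i, b i ^ q) ^ (1 / q) ≤ (∑ i, c i ^ q) ^ (1 / q) :=
    Real.rpow_le_rpow (Finset.sum_nonneg fun i _ => Real.rpow_nonneg (hb i) q) h
      (one_div_nonneg.2 q_nonneg)
  have le_of_forall_partition_le {B : ℝ} (hB : ∀ X : Fin n → Set Ω, IsMeasurablePartition X →
      (∑ i, ‖(μ i).proj (X i)‖ ^ q) ^ (1 / q) ≤ B) {φ : Fin n → StrongDual ℂ (RegMeasure Ω)}
      (hφ : ∀ ν, ∑ i, ‖φ i ν‖ ≤ ‖ν‖) : (∑ i, ‖φ i (μ i)‖ ^ q) ^ (1 / q) ≤ B := by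
    obtain ⟨X, hX, hle⟩ := RegMeasure.exists_isMeasurablePartition_sum_rpow_le hq hφ μ
    exact (rpow_mono (fun _ => norm_nonneg _) hle).trans (hB X hX)
  have partition_le (X : Fin n → Set Ω) (hX : IsMeasurablePartition X) :
      (∑ i, ‖(μ i).proj (X i)‖ ^ q) ^ (1 / q) ≤ (∑ i, ‖μ i‖ ^ q) ^ (1 / q) :=
    rpow_mono (fun _ => norm_nonneg _) <| Finset.sum_le_sum fun i _ =>
      Real.rpow_le_rpow (norm_nonneg _) (RegMeasure.norm_proj_le (hX.measurableSet i) _) q_nonneg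
  simp only [weakMultiNorm, weakSummingNorm_one_le_one_iff]
  refine ⟨?_, fun B hB => ?_⟩
  · rintro _ ⟨X, hX, rfl⟩
    obtain ⟨φ, hφ, norm_apply_eq⟩ := hX.exists_sum_norm_apply_le_and_norm_apply_eq μ
    refine le_csSup ⟨(∑ i, ‖μ i‖ ^ q) ^ (1 / q), ?_⟩ ⟨φ, hφ, by simp only [norm_apply_eq]⟩
    rintro _ ⟨φ, hφ, rfl⟩
    exact le_of_forall_partition_le partition_le hφ
  · refine csSup_le ⟨_, 0, fun ν => by simp, rfl⟩ ?_
    rintro _ ⟨φ, hφ, rfl⟩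
    exact le_of_forall_partition_le (fun X hX => hB ⟨X, hX, rfl⟩) hφ

end WeakMultiNorm

theorem mainTheorem9_general {Ω : Type*} [TopologicalSpace Ω] [T2Space Ω] [MeasurableSpace Ω]
    [BorelSpace Ω] :
    IsMaximumMultiNorm (E := RegMeasure Ω)
      (fun _ μ => ((⨆ i, (μ i).abs) Set.univ).toReal) ∧
    ∀ q : ℝ, 1 ≤ q → ∀ n : ℕ, 1 ≤ n → ∀ μ : Fin n → RegMeasure Ω,
      IsLUB {r : ℝ | ∃ X : Fin n → Set Ω, IsMeasurablePartition X ∧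
          r = (∑ i, ‖(μ i).proj (X i)‖ ^ q) ^ (1 / q)}
        (weakMultiNorm 1 q μ) := by
  refine ⟨RegMeasure.isMaximumMultiNorm_latticeNorm, fun q hq n hn μ => ?_⟩
  have : NeZero n := ⟨Nat.one_le_iff_ne_zero.1 hn⟩
  exact isLUB_weakMultiNorm_one hq μ

/-- (1) The maximum multi-norm over `M(Ω)` is `‖|μ_1| ∨ ⋯ ∨ |μ_n|‖`, the total mass of the
supremum of the positive measures `|μ_i|`.
(2) For `1 ≤ q < ∞`, the weak `(1,q)`-multi-norm over `M(Ω)` is the supremum of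
`(∑ ‖P_{X_i} μ_i‖^q)^{1/q}` over the measurable partitions `(X_1, …, X_n)` of `Ω`. -/
theorem mainTheorem9 {Ω : Type*} [TopologicalSpace Ω] [T2Space Ω] [LocallyCompactSpace Ω]
    [MeasurableSpace Ω] [BorelSpace Ω] :
    IsMaximumMultiNorm (E := RegMeasure Ω)
      (fun _ μ => ((⨆ i, (μ i).abs) Set.univ).toReal) ∧
    ∀ q : ℝ, 1 ≤ q → ∀ n : ℕ, 1 ≤ n → ∀ μ : Fin n → RegMeasure Ω,
      IsLUB {r : ℝ | ∃ X : Fin n → Set Ω, IsMeasurablePartition X ∧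
          r = (∑ i, ‖(μ i).proj (X i)‖ ^ q) ^ (1 / q)}
        (weakMultiNorm 1 q μ) :=
  mainTheorem9_general
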